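/- Let $d\ge 1$ be an integer and let $\mathcal P(d)$ be the set of partitions $\lambda=(b_1\ge\cdots\ge b_d\ge 0)$ with at most $d$ rows; put $\bar\lambda_i:=b_i+(d-i+1)$ for $1\le i\le d$. Let $x=(x_1,\dots,x_d)$, $v=(v_1,\dots,v_d)$, $a=(a_l)_{l\ge 1}$ and $w=(w_l)_{l\ge 1}$ be variables. For $\lambda\in\mathcal P(d)$ let $$s_\lambda(x|a):=\frac{\det\big[(x_j|a)^{b_i+d-i}\big]_{1\le i,j\le d}}{\prod_{i<j}(x_i-x_j)}\in\mathbb Z[x,a],\qquad (y|a)^k:=(y-a_1)\cdots(y-a_k),$$ be the factorial Schur function. Let $\mathbb Z[w]_{\mathrm{loc}}$ be the localization of $\mathbb Z[w]$ at the multiplicative set of finite products of the elements $w_\lambda:=\sum_{i=1}^d w_{\bar\lambda_i}$, $\lambda\in\mathcal P(d)$, and $\mathbb Z[v]_{\mathrm{loc}}$ the localization of $\mathbb Z[v]$ at the powers of $v_\bullet:=v_1+\cdots+v_d$. Put $\mathbb Z[w]_{\mathrm{loc}}[a]:=\mathbb Z[w]_{\mathrm{loc}}\otimes_{\mathbb Z}\mathbb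 Z[a]$ and $\mathbb Z[v]_{\mathrm{loc}}[x]:=\mathbb Z[v]_{\mathrm{loc}}\otimes_{\mathbb Z}\mathbb Z[x]$, and let $(\mathbb Z[v]_{\mathrm{loc}}[x])^{S_d}$ be the ring of invariants under simultaneous permutations of the $v_i$ and the $x_i$. Let $x_\bullet:=x_1+\cdots+x_d$ and $$x^v_i:=x_i-\frac{v_i}{v_\bullet}x_\bullet,\qquad a^{vw}_l:=a_l-\frac{w_l}{v_\bullet}x_\bullet,\qquad 0^{vw}_l:=-\frac{w_l}{v_\bullet}x_\bullet .$$ The weighted factorial Schur functions and the weighted Schur functions are $$s^w_\lambda(v;x|a):=s_\lambda(x^v|a^{vw}),\qquad s^w_\lambda(v;x):=s_\lambda(x^v|0^{vw})\qquad(\lambda\in\mathcal P(d)).$$ Then: (1) The $\mathbb Z[w]_{\mathrm{loc}}[a]$-span of the functions $s^w_\lambda(v;x|a)$, $\lambda\in\mathcal P(d)$, is a $\mathbb Z[w]_{\mathrm{loc}}[a]$-subalgebra of $\mathbb Z[w]_{\mathrm{loc}}[a]\otimes_{\mathbb Z}(\mathbb Z[v]_{\mathrm{loc}}[x])^{S_d}$,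 and these functions form a basis of it as a $\mathbb Z[w]_{\mathrm{loc}}[a]$-module. (2) The $\mathbb Z[w]_{\mathrm{loc}}$-span of the functions $s^w_\lambda(v;x)$, $\lambda\in\mathcal P(d)$, is a $\mathbb Z[w]_{\mathrm{loc}}$-subalgebra of $\mathbb Z[w]_{\mathrm{loc}}\otimes_{\mathbb Z}(\mathbb Z[v]_{\mathrm{loc}}[x])^{S_d}$, and these functions form a basis of it as a $\mathbb Z[w]_{\mathrm{loc}}$-module. -/

import Mathlib

open scoped TensorProduct

noncomputable section

namespace WeightedSchur

/-- Partitions with at most `d` rows: weakly decreasing sequences `b_1 ≥ ⋯ ≥ b_d ≥ 0`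
of row lengths. Rows are indexed from `0`. -/
abbrev Part (d : ℕ) : Type := {b : Fin d → ℕ // Antitone b}

/-- The number `b_i + d - i` (rows counted from `1`). The variables `a_1, a_2, …` and
`w_1, w_2, …` are indexed by `ℕ` with `a_{l+1}` at index `l`, so `idx lam i` is also the position
of the variable with the classical index `b_i + (d - i + 1)`. -/
def idx {d : ℕ} (lam : Part d) (i : Fin d) : ℕ := lam.1 i + (d - 1 - (i : ℕ))

/-! ### Factorial Schur polynomials -/

/-- The polynomial ring `ℤ[x_1, …, x_d, a_1, a_2, …]`. -/
abbrev XA (d : ℕ) : Type := MvPolynomial (Fin d ⊕ ℕ) ℤ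

/-- The variable `x_i`. -/
def varX {d : ℕ} (i : Fin d) : XA d := MvPolynomial.X (Sum.inl i)

/-- The variable `a_{l+1}`. -/
def varA (d : ℕ) (l : ℕ) : XA d := MvPolynomial.X (Sum.inr l)

/-- The factorial power `(y | a)^k = (y - a_1) ⋯ (y - a_k)`. -/
def factorialPow {d : ℕ} (y : XA d) (k : ℕ) : XA d := ∏ l ∈ Finset.range k, (y - varA d l)

/-- The numerator `det [(x_j | a)^{b_i + d - i}]`. -/
def numerator {d : ℕ} (lam : Part d) : XA d :=
  (Matrix.of fun i j : Fin d => factorialPow (varX j) (idx lam i)).det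

/-- The denominator `∏_{i < j} (x_i - x_j)`. -/
def denominator (d : ℕ) : XA d := ∏ i : Fin d, ∏ j ∈ Finset.Ioi i, (varX i - varX j)

theorem irreducible_sub {d : ℕ} {i j : Fin d} (h : i ≠ j) :
    Irreducible (varX i - varX j : XA d) := by
  have hne : (Sum.inl i : Fin d ⊕ ℕ) ≠ Sum.inl j := fun e => h (Sum.inl.inj e)
  have hc : MvPolynomial.coeff (Finsupp.single (Sum.inl i) 1) (varX i - varX j : XA d) = 1 := by
    have hs : (Finsupp.single (Sum.inl j) 1 : Fin d ⊕ ℕ →₀ ℕ) ≠ Finsupp.single (Sum.inl i) 1 := by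
      intro e
      exact hne ((Finsupp.single_left_inj one_ne_zero).1 e).symm
    simp [varX, MvPolynomial.coeff_X, hs]
  apply MvPolynomial.irreducible_of_totalDegree_eq_one
  · apply le_antisymm
    · refine (MvPolynomial.totalDegree_sub _ _).trans ?_
      simp [varX]
    · have hm : Finsupp.single (Sum.inl i) 1 ∈ (varX i - varX j : XA d).support := by
        rw [MvPolynomial.mem_support_iff, hc]; exact one_ne_zero
      have := MvPolynomial.le_totalDegree hm
      simpa using this
  · intro x hx
    have := hx (Finsupp.single (Sum.inl i) 1)
    rw [hc] at this
    exact isUnit_of_dvd_one this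

theorem not_dvd_sub {d : ℕ} {i j k l : Fin d} (hij : i < j) (hkl : k < l)
    (h : (i, j) ≠ (k, l)) : ¬ (varX i - varX j : XA d) ∣ varX k - varX l := by
  intro hdvd
  let p : Fin d ⊕ ℕ → ℤ := Sum.elim (fun m => if m = i then (j : ℤ) else (m : ℤ)) 0
  have h1 := map_dvd (MvPolynomial.eval p) hdvd
  have hz : MvPolynomial.eval p (varX i - varX j : XA d) = 0 := by
    simp [varX, p]
  rw [hz, zero_dvd_iff] at h1
  simp only [varX, p, map_sub, MvPolynomial.eval_X, Sum.elim_inl] at h1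
  split_ifs at h1 with h2 h3 h3
  · omega
  · subst h2
    apply h
    have : j = l := by
      apply Fin.ext
      omega
    rw [this]
  · subst h3
    have : (k : ℕ) = j := by omega
    omega
  · omega

theorem sub_dvd_numerator {d : ℕ} (lam : Part d) {i j : Fin d} (h : i ≠ j) :
    (varX i - varX j : XA d) ∣ numerator lam := by
  rw [← Ideal.mem_span_singleton, ← Ideal.Quotient.eq_zero_iff_mem, numerator, RingHom.map_det]
  apply Matrix.det_zero_of_column_eq h
  intro k
  have e : Ideal.Quotient.mk (Ideal.span {(varX i - varX j : XA d)}) (varX i)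
      = Ideal.Quotient.mk _ (varX j) := by
    rw [Ideal.Quotient.eq]
    exact Ideal.mem_span_singleton_self _
  simp [factorialPow, map_prod, map_sub, e]

theorem denominator_dvd {d : ℕ} (lam : Part d) : denominator d ∣ numerator lam := by
  rw [denominator, Finset.prod_sigma']
  apply Finset.prod_dvd_of_isRelPrime
  · rintro ⟨i, j⟩ hij ⟨k, l⟩ hkl hne
    simp only [Finset.coe_sigma, Set.mem_sigma_iff, Finset.mem_coe, Finset.mem_Ioi] at hij hkl
    refine (irreducible_sub hij.2.ne).isRelPrime_iff_not_dvd.2 (not_dvd_sub hij.2 hkl.2 ?_)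
    intro e
    simp only [Prod.mk.injEq] at e
    obtain ⟨rfl, rfl⟩ := e
    exact hne rfl
  · rintro ⟨i, j⟩ hij
    simp only [Finset.mem_sigma, Finset.mem_Ioi] at hij
    exact sub_dvd_numerator lam hij.2.ne

/-- The factorial Schur function `s_lam(x | a)`, the quotient of the numerator by the
denominator, as a polynomial in `x` and `a`. -/
def factorialSchur {d : ℕ} (lam : Part d) : XA d := Classical.choose (denominator_dvd lam)

theorem denominator_mul_factorialSchur {d : ℕ} (lam : Part d) :
    denominator d * factorialSchur lam = numerator lam :=
  (Classical.choose_spec (denominator_dvd lam)).symm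

theorem denominator_ne_zero (d : ℕ) : denominator d ≠ 0 :=
  Finset.prod_ne_zero_iff.2 fun _ _ => Finset.prod_ne_zero_iff.2 fun _ hj =>
    (irreducible_sub (Finset.mem_Ioi.1 hj).ne).ne_zero

/-! ### The coefficient rings -/

/-- `w_lam`, the sum of the `w`-variables with index `b_i + (d - i + 1)`, `i = 1, …, d`. -/
def wSum {d : ℕ} (lam : Part d) : MvPolynomial ℕ ℤ := ∑ i, MvPolynomial.X (idx lam i)

/-- The multiplicative set of all finite products of the `w_lam`. -/
def wSubmonoid (d : ℕ) : Submonoid (MvPolynomial ℕ ℤ) :=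
  Submonoid.closure (Set.range fun lam : Part d => wSum lam)

/-- `ℤ[w]_loc`. -/
def Wloc (d : ℕ) : Type := Localization (wSubmonoid d)

instance commRing_Wloc (d : ℕ) : CommRing (Wloc d) :=
  inferInstanceAs (CommRing (Localization (wSubmonoid d)))

instance algebra_Wloc (d : ℕ) : Algebra (MvPolynomial ℕ ℤ) (Wloc d) :=
  inferInstanceAs (Algebra (MvPolynomial ℕ ℤ) (Localization (wSubmonoid d)))

instance isLocalization_Wloc (d : ℕ) : IsLocalization (wSubmonoid d) (Wloc d) :=
  inferInstanceAs (IsLocalization (wSubmonoid d) (Localization (wSubmonoid d)))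

/-- The variable `w_{l+1}` in `ℤ[w]_loc`. -/
def varW (d : ℕ) (l : ℕ) : Wloc d :=
  algebraMap (MvPolynomial ℕ ℤ) (Wloc d) (MvPolynomial.X l)

/-- `ℤ[w]_loc[a]`. -/
abbrev WlocA (d : ℕ) : Type := MvPolynomial ℕ (Wloc d)

/-- The sum of all `v`-variables in `ℤ[v]`. -/
def vSum (d : ℕ) : MvPolynomial (Fin d) ℤ := ∑ i, MvPolynomial.X i

/-- `ℤ[v]_loc`. -/
def Vloc (d : ℕ) : Type := Localization.Away (vSum d)

instance commRing_Vloc (d : ℕ) : CommRing (Vloc d) :=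
  inferInstanceAs (CommRing (Localization.Away (vSum d)))

instance algebra_Vloc (d : ℕ) : Algebra (MvPolynomial (Fin d) ℤ) (Vloc d) :=
  inferInstanceAs (Algebra (MvPolynomial (Fin d) ℤ) (Localization.Away (vSum d)))

instance isLocalization_Vloc (d : ℕ) : IsLocalization.Away (vSum d) (Vloc d) :=
  inferInstanceAs (IsLocalization.Away (vSum d) (Localization.Away (vSum d)))

/-- `ℤ[v]_loc[x]`. -/
abbrev VX (d : ℕ) : Type := MvPolynomial (Fin d) (Vloc d)

/-! ### Simultaneous permutations of `v` and `x` -/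

theorem rename_vSum {d : ℕ} (σ : Equiv.Perm (Fin d)) :
    MvPolynomial.rename σ (vSum d) = vSum d := by
  simp only [vSum, map_sum, MvPolynomial.rename_X]
  exact Equiv.sum_comp σ (fun i => (MvPolynomial.X i : MvPolynomial (Fin d) ℤ))

/-- The automorphism `v_i ↦ v_{σ(i)}` of `ℤ[v]_loc`. -/
def permV {d : ℕ} (σ : Equiv.Perm (Fin d)) : Vloc d →+* Vloc d :=
  IsLocalization.map (M := Submonoid.powers (vSum d)) (T := Submonoid.powers (vSum d)) (Vloc d)
    (MvPolynomial.rename σ : MvPolynomial (Fin d) ℤ →ₐ[ℤ] MvPolynomial (Fin d) ℤ).toRingHom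
    (by
      rw [Submonoid.powers_le]
      exact ⟨1, by simpa using (rename_vSum σ).symm⟩)

/-- The automorphism `v_i ↦ v_{σ(i)}`, `x_i ↦ x_{σ(i)}` of `ℤ[v]_loc[x]`. -/
def permVX {d : ℕ} (σ : Equiv.Perm (Fin d)) : VX d →+* VX d :=
  MvPolynomial.eval₂Hom (MvPolynomial.C.comp (permV σ)) fun i => MvPolynomial.X (σ i)

/-- The invariant ring `(ℤ[v]_loc[x])^{S_d}`. -/
def invVX (d : ℕ) : Subalgebra ℤ (VX d) where
  carrier := {f | ∀ σ : Equiv.Perm (Fin d), permVX σ f = f}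
  mul_mem' hf hg σ := by rw [map_mul, hf σ, hg σ]
  add_mem' hf hg σ := by rw [map_add, hf σ, hg σ]
  algebraMap_mem' n σ := by simp

/-- The natural map `R ⊗ (ℤ[v]_loc[x])^{S_d} → R ⊗ ℤ[v]_loc[x]`. -/
def invIncl (d : ℕ) (R : Type) [CommRing R] :
    R ⊗[ℤ] (invVX d) →ₐ[R] R ⊗[ℤ] (VX d) :=
  Algebra.TensorProduct.map (AlgHom.id R R) (invVX d).val

/-- For flat `R` (all coefficient rings below are flat over `ℤ`) the natural map is injective. -/
theorem invIncl_injective (d : ℕ) (R : Type) [CommRing R] [Module.Flat ℤ R] :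
    Function.Injective (invIncl d R) :=
  Module.Flat.lTensor_preserves_injective_linearMap (M := R) (invVX d).val.toLinearMap
    Subtype.val_injective

instance flat_Wloc (d : ℕ) : Module.Flat ℤ (Wloc d) :=
  haveI : Module.Flat (MvPolynomial ℕ ℤ) (Wloc d) := IsLocalization.flat (Wloc d) (wSubmonoid d)
  Module.Flat.trans ℤ (MvPolynomial ℕ ℤ) (Wloc d)

instance flat_WlocA (d : ℕ) : Module.Flat ℤ (WlocA d) := inferInstance

/-- `R ⊗ (ℤ[v]_loc[x])^{S_d}`, as an `R`-subalgebra of `R ⊗ ℤ[v]_loc[x]`. -/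
def invariants (d : ℕ) (R : Type) [CommRing R] : Subalgebra R (R ⊗[ℤ] (VX d)) :=
  (invIncl d R).range

/-! ### Weighted (factorial) Schur functions -/

/-- `x_1 + ⋯ + x_d` divided by `v_1 + ⋯ + v_d`. -/
def xOverV (d : ℕ) : VX d :=
  MvPolynomial.C (IsLocalization.Away.invSelf (vSum d)) * ∑ i, MvPolynomial.X i

/-- The shifted variable `x_i - (v_i / v) x`, where `v` and `x` are the sums of the
`v`- and the `x`-variables. -/
def shiftX {d : ℕ} (i : Fin d) : VX d :=
  MvPolynomial.X i -
    MvPolynomial.C (algebraMap (MvPolynomial (Fin d) ℤ) (Vloc d) (MvPolynomial.X i)) * xOverV d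

/-- The shifted parameter `a_l - (w_l / v) x`, for sequences `w`, `a` in a coefficient ring. -/
def shiftA (d : ℕ) {R : Type} [CommRing R] (w a : ℕ → R) (l : ℕ) : R ⊗[ℤ] (VX d) :=
  a l ⊗ₜ[ℤ] 1 - w l ⊗ₜ[ℤ] xOverV d

/-- The factorial Schur polynomial evaluated at the shifted variables and parameters. -/
def shiftedSchur {d : ℕ} {R : Type} [CommRing R] (w a : ℕ → R) (lam : Part d) :
    R ⊗[ℤ] (VX d) :=
  MvPolynomial.aeval (R := ℤ)
    (Sum.elim (fun i : Fin d => (1 : R) ⊗ₜ[ℤ] shiftX i) (shiftA d w a)) (factorialSchur lam)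

/-- The weighted factorial Schur function `s^w_lam(v; x | a)`. -/
def weightedFactorialSchur {d : ℕ} (lam : Part d) : WlocA d ⊗[ℤ] VX d :=
  shiftedSchur (fun l => MvPolynomial.C (varW d l)) (fun l => MvPolynomial.X l) lam

/-- The weighted Schur function `s^w_lam(v; x)`. -/
def weightedSchur {d : ℕ} (lam : Part d) : Wloc d ⊗[ℤ] VX d :=
  shiftedSchur (varW d) (fun _ => 0) lam

/-- The `ℤ[w]_loc[a]`-span of the weighted factorial Schur functions. -/
def factorialSpan (d : ℕ) : Submodule (WlocA d) (WlocA d ⊗[ℤ] VX d) :=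
  Submodule.span (WlocA d) (Set.range fun lam : Part d => weightedFactorialSchur lam)

/-- The `ℤ[w]_loc`-span of the weighted Schur functions. -/
def schurSpan (d : ℕ) : Submodule (Wloc d) (Wloc d ⊗[ℤ] VX d) :=
  Submodule.span (Wloc d) (Set.range fun lam : Part d => weightedSchur lam)

end WeightedSchur

end

/-!
Let `R` be a domain that contains the parameters `a_l`, `w_l` and in which every `w_lam` is a unit;
both `ℤ[w]_loc[a]` and `ℤ[w]_loc` (with `a = 0`) are of this kind. Put `A = R[t]` and
`b_l = a_l - w_l t`. The weighted functions are the images of the factorial Schur polynomials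
`s_lam(x | b)` in `A[x_1, …, x_d]` under the homomorphism `shiftEval`, which sends `x_i` to the
shifted variable and `t` to the quotient of `x_1 + ⋯ + x_d` by `v_1 + ⋯ + v_d`.

Over `A` the `s_lam(x | b)` form a basis of the symmetric polynomials
(`mem_span_schur_of_isSymmetric`, `linearIndependent_schur`), and the Pieri rule
(`exists_sum_X_mul_schur`) says that `(x_1 + ⋯ + x_d) s_lam` is `(a_lam - w_lam t) s_lam` plus an
integral combination of Schur polynomials, where `a_lam` is the analogue of `w_lam`.

The shifted variables sum to zero, so `shiftEval` kills `x_1 + ⋯ + x_d`. After `shiftEval` the Pieri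
rule therefore expresses `w_lam t s_lam` through Schur functions with coefficients in `R`. As `w_lam`
is a unit, the `R`-span of the images is stable under `t`, hence equals the image of all symmetric
polynomials, which is a subalgebra (`toSubmodule_shiftedAlgebra`).

For independence, the kernel of `shiftEval` is generated by `x_1 + ⋯ + x_d`: the specialisation
`v = (1, 0, …, 0)` followed by a translation by `t` is an inverse modulo this element
(`sum_X_dvd_of_shiftEval_eq_zero`). So an `R`-linear relation gives an identity
`∑ c_lam s_lam = (x_1 + ⋯ + x_d) g` with `c_lam` free of `t` and `g` symmetric. By the Pieri rule,
the right side has a coefficient of positive degree in `t` unless `g = 0`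
(`linearIndependent_shiftedSchur`).
-/

open scoped TensorProduct

noncomputable section

namespace WeightedSchur

open MvPolynomial

section

variable {d : ℕ} {A : Type*} [CommRing A]

/-! ### Partitions as strictly decreasing exponents -/

theorem idx_strictAnti (lam : Part d) : StrictAnti (idx lam) := by
  intro i j hij
  have h1 := lam.2 hij.le
  have h2 : (i : ℕ) < j := hij
  simp only [idx]
  omega

theorem idx_injective : Function.Injective (idx : Part d → Fin d → ℕ) := by
  intro lam mu h
  apply Subtype.ext
  funext i
  have := congrFun h i
  simp only [idx] at this
  omega

theorem add_sub_le_of_strictAnti {k : Fin d → ℕ} (hk : StrictAnti k) {i j : Fin d}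
    (hij : i ≤ j) : k j + ((j : ℕ) - i) ≤ k i := by
  obtain ⟨n, hn⟩ : ∃ n, (j : ℕ) = i + n := Nat.exists_eq_add_of_le hij
  induction n generalizing j with
  | zero =>
    obtain rfl : j = i := Fin.ext hn
    omega
  | succ n ih =>
    have hj := j.2
    have h1 := @ih ⟨i + n, by omega⟩ (Fin.le_def.2 (by simp)) rfl
    have h2 : k j < k ⟨i + n, by omega⟩ := hk (Fin.lt_def.2 (by simp only; omega))
    simp only at h1
    omega

theorem exists_idx_eq {k : Fin d → ℕ} (hk : StrictAnti k) : ∃ lam : Part d, idx lam = k := by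
  have hlow (i : Fin d) : d - 1 - (i : ℕ) ≤ k i := by
    have hi := i.2
    have := add_sub_le_of_strictAnti hk (i := i) (j := ⟨d - 1, by omega⟩)
      (Fin.le_def.2 (by simp only; omega))
    simp only at this
    omega
  refine ⟨⟨fun i => k i - (d - 1 - (i : ℕ)), fun i j hij => ?_⟩, ?_⟩
  · have h1 := add_sub_le_of_strictAnti hk hij
    have h2 := hlow i
    have h3 := hlow j
    have h4 : (i : ℕ) ≤ j := hij
    have h5 := j.2
    simp only
    omega
  · funext i
    have := hlow i
    simp only [idx]
    omega

/-! ### Factorial alternants -/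

/-- The alternant `det [(x_j | b)^{k_i}]` for an arbitrary sequence of exponents `k`, over a
coefficient ring containing the parameters `b`. -/
def alternant (b : ℕ → A) (k : Fin d → ℕ) : MvPolynomial (Fin d) A :=
  (Matrix.of fun i j : Fin d => ∏ l ∈ Finset.range (k i), (X j - C (b l))).det

/-- The factorial monomial `∏_i (x_i | b)^{k_i}`. -/
def factorialMonomial (b : ℕ → A) (k : Fin d → ℕ) : MvPolynomial (Fin d) A :=
  ∏ i, ∏ l ∈ Finset.range (k i), (X i - C (b l))

/-- The Vandermonde product `∏_{i < j} (x_i - x_j)`. -/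
def vandermondeProd (d : ℕ) (A : Type*) [CommRing A] : MvPolynomial (Fin d) A :=
  ∏ i : Fin d, ∏ j ∈ Finset.Ioi i, (X i - X j)

/-- The factorial Schur function with its parameters specialised to `b`. -/
def schur (b : ℕ → A) (lam : Part d) : MvPolynomial (Fin d) A :=
  aeval (R := ℤ) (Sum.elim X fun l => C (b l)) (factorialSchur lam)

theorem vandermondeProd_mul_schur (b : ℕ → A) (lam : Part d) :
    vandermondeProd d A * schur b lam = alternant b (idx lam) := by
  have h := congrArg (aeval (R := ℤ) (Sum.elim X fun l => C (b l) : _ → MvPolynomial (Fin d) A))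
    (denominator_mul_factorialSchur lam)
  rw [map_mul] at h
  convert h using 1
  · simp [vandermondeProd, schur, denominator, varX]
  · rw [numerator, AlgHom.map_det, alternant]
    congr 1
    ext1 i j
    simp [factorialPow, varX, varA]

theorem vandermondeProd_ne_zero [IsDomain A] : vandermondeProd d A ≠ 0 := by
  refine Finset.prod_ne_zero_iff.2 fun i _ => Finset.prod_ne_zero_iff.2 fun j hj => ?_
  rw [sub_ne_zero]
  exact fun h => (Finset.mem_Ioi.1 hj).ne (X_injective h)

/-- The factorial power as a polynomial in one variable. -/
def factorialPoly (b : ℕ → A) (k : ℕ) : Polynomial A :=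
  ∏ l ∈ Finset.range k, (Polynomial.X - Polynomial.C (b l))

theorem factorialPoly_monic (b : ℕ → A) (k : ℕ) : (factorialPoly b k).Monic :=
  Polynomial.monic_prod_of_monic _ _ fun _ _ => Polynomial.monic_X_sub_C _

theorem natDegree_factorialPoly [Nontrivial A] (b : ℕ → A) (k : ℕ) :
    (factorialPoly b k).natDegree = k := by
  rw [factorialPoly, Polynomial.natDegree_prod_of_monic _ _
    fun _ _ => Polynomial.monic_X_sub_C _]
  simp

theorem aeval_factorialPoly (b : ℕ → A) (k : ℕ) (i : Fin d) :
    Polynomial.aeval (X i : MvPolynomial (Fin d) A) (factorialPoly b k) =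
      ∏ l ∈ Finset.range k, (X i - C (b l)) := by
  simp [factorialPoly, map_prod, algebraMap_eq]

/-- The empty partition. -/
def emptyPart (d : ℕ) : Part d := ⟨fun _ => 0, antitone_const⟩

/-- The factorial powers are monic polynomials of the right degrees, so the alternant of the empty
partition is a Vandermonde determinant. -/
theorem alternant_emptyPart [Nontrivial A] (b : ℕ → A) :
    alternant b (idx (emptyPart d)) = vandermondeProd d A := by
  have h := Matrix.det_eval_matrixOfPolynomials_eq_det_vandermonde
    (fun i : Fin d => (X i.rev : MvPolynomial (Fin d) A))
    (fun i => (factorialPoly b i).map C)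
    (fun i => by rw [(factorialPoly_monic b i).natDegree_map, natDegree_factorialPoly])
    (fun i => (factorialPoly_monic b i).map _)
  rw [Matrix.det_vandermonde] at h
  have h1 : vandermondeProd d A =
      ∏ i : Fin d, ∏ j ∈ Finset.Ioi i, (X j.rev - X i.rev : MvPolynomial (Fin d) A) := by
    rw [vandermondeProd, Finset.prod_sigma', Finset.prod_sigma']
    refine Finset.prod_bij' (fun p _ => ⟨p.2.rev, p.1.rev⟩) (fun p _ => ⟨p.2.rev, p.1.rev⟩)
      ?_ ?_ ?_ ?_ ?_ <;> simp
  rw [h1, h, alternant, ← Matrix.det_transpose, ← Matrix.det_submatrix_equiv_self Fin.revPerm]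
  congr 1
  ext1 i j
  have hj := j.2
  have : d - 1 - (d - (j + 1 : ℕ)) = j := by omega
  simp only [Matrix.submatrix_apply, Matrix.transpose_apply, Matrix.of_apply, Fin.revPerm_apply]
  rw [← aeval_factorialPoly, Polynomial.eval_map, idx]
  simp [emptyPart, Fin.val_rev, this, Polynomial.aeval_def, algebraMap_eq]

/-- Sorting the rows shows that every alternant is zero or plus or minus the alternant of a
partition. The coefficients are integers, which matters in the Pieri rule. -/
theorem exists_alternant_eq (b : ℕ → A) (k : Fin d → ℕ) :
    ∃ z ∈ Submodule.span ℤ (Set.range (schur b : Part d → _)),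
      alternant b k = vandermondeProd d A * z := by
  by_cases hk : Function.Injective k
  · let σ : Equiv.Perm (Fin d) := Fin.revPerm.trans (Tuple.sort k)
    have hσ : StrictAnti (k ∘ σ) := by
      have h1 : Antitone (k ∘ σ) := fun i j hij =>
        Tuple.monotone_sort k (Fin.rev_le_rev.2 hij)
      exact h1.strictAnti_of_injective (hk.comp σ.injective)
    obtain ⟨lam, hlam⟩ := exists_idx_eq hσ
    have h2 := Matrix.det_permute σ
      (Matrix.of fun i j : Fin d => ∏ l ∈ Finset.range (k i), (X j - C (b l)))
    have h3 : alternant b (idx lam) = ((Equiv.Perm.sign σ : ℤ) : MvPolynomial (Fin d) A) *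
        alternant b k := by
      rw [hlam]
      exact h2
    refine ⟨(Equiv.Perm.sign σ : ℤ) • schur b lam,
      Submodule.smul_mem _ _ (Submodule.subset_span ⟨lam, rfl⟩), ?_⟩
    rw [mul_smul_comm, vandermondeProd_mul_schur, h3, zsmul_eq_mul, ← mul_assoc, ← Int.cast_mul]
    simp
  · obtain ⟨i, j, hij, hne⟩ : ∃ i j, k i = k j ∧ i ≠ j := by
      simpa [Function.Injective] using hk
    refine ⟨0, zero_mem _, ?_⟩
    rw [mul_zero]
    refine Matrix.det_zero_of_row_eq hne ?_
    funext l
    simp [hij]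

/-! ### The Pieri rule -/

/-- Multiplying a determinant by the sum of all `x_j` amounts to multiplying, in one row at a time,
the entry in column `j` by `x_j`. -/
theorem sum_mul_det {n B : Type*} [Fintype n] [DecidableEq n] [CommRing B] (x : n → B)
    (M : Matrix n n B) :
    (∑ j, x j) * M.det = ∑ i, (M.updateRow i fun j => x j * M i j).det := by
  have h (i : n) : (M.updateRow i fun j => x j * M i j).det =
      ∑ j, x j * (M i j * M.adjugate j i) := by
    rw [Matrix.det_eq_sum_mul_adjugate_row _ i]
    refine Finset.sum_congr rfl fun j _ => ?_
    rw [Matrix.updateRow_self, Matrix.adjugate_apply, Matrix.adjugate_apply, mul_assoc,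
      Matrix.updateRow_idem]
  simp_rw [h]
  rw [Finset.sum_comm, Finset.sum_mul]
  refine Finset.sum_congr rfl fun j _ => ?_
  rw [← Finset.mul_sum]
  congr 1
  have := congrFun (congrFun (Matrix.adjugate_mul M) j) j
  rw [Matrix.mul_apply] at this
  simp only [Matrix.smul_apply, Matrix.one_apply_eq, smul_eq_mul, mul_one] at this
  rw [← this]
  exact Finset.sum_congr rfl fun i _ => mul_comm _ _

theorem sum_X_mul_alternant (b : ℕ → A) (k : Fin d → ℕ) :
    (∑ j, X j) * alternant b k =
      C (∑ i, b (k i)) * alternant b k + ∑ i, alternant b (Function.update k i (k i + 1)) := by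
  rw [alternant, sum_mul_det, map_sum, Finset.sum_mul, ← Finset.sum_add_distrib]
  refine Finset.sum_congr rfl fun i _ => ?_
  have h (j : Fin d) : X j * ∏ l ∈ Finset.range (k i), (X j - C (b l)) =
      C (b (k i)) * ∏ l ∈ Finset.range (k i), (X j - C (b l)) +
        ∏ l ∈ Finset.range (k i + 1), (X j - C (b l)) := by
    rw [Finset.prod_range_succ]
    ring
  simp only [Matrix.of_apply, h]
  set M : Matrix (Fin d) (Fin d) (MvPolynomial (Fin d) A) :=
    Matrix.of fun i j => ∏ l ∈ Finset.range (k i), (X j - C (b l)) with hM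
  have e := Matrix.det_updateRow_add M i ((C (b (k i)) : MvPolynomial (Fin d) A) • M i)
    (fun j => ∏ l ∈ Finset.range (k i + 1), (X j - C (b l)))
  rw [Matrix.det_updateRow_smul, Matrix.updateRow_eq_self] at e
  refine e.trans ?_
  congr 1
  rw [alternant]
  congr 1
  ext1 r j
  by_cases hr : r = i
  · subst hr
    simp
  · simp [hr, hM]

/-- The Pieri rule for multiplication by `x_1 + ⋯ + x_d`; of the terms obtained by adding a box only
their integrality is recorded. -/
theorem exists_sum_X_mul_schur [IsDomain A] (b : ℕ → A) (lam : Part d) :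
    ∃ z ∈ Submodule.span ℤ (Set.range (schur b : Part d → _)),
      (∑ j, X j) * schur b lam = C (∑ i, b (idx lam i)) * schur b lam + z := by
  choose z hz hz' using fun i => exists_alternant_eq b
    (Function.update (idx lam) i (idx lam i + 1))
  refine ⟨∑ i, z i, Submodule.sum_mem _ fun i _ => hz i, ?_⟩
  apply mul_left_cancel₀ (vandermondeProd_ne_zero (A := A) (d := d))
  have h := sum_X_mul_alternant b (idx lam)
  rw [← vandermondeProd_mul_schur] at h
  rw [mul_add, Finset.mul_sum, ← Finset.sum_congr rfl fun i _ => hz' i]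
  linear_combination h

/-! ### Factorial Schur functions form a basis of the symmetric polynomials -/

/-- The antisymmetrization `∑_σ sgn(σ) σ`, without the factor `1 / d!`. -/
def antisymmetrize (d : ℕ) (A : Type*) [CommRing A] :
    MvPolynomial (Fin d) A →ₗ[A] MvPolynomial (Fin d) A :=
  ∑ σ : Equiv.Perm (Fin d), (Equiv.Perm.sign σ : ℤ) • (rename σ).toLinearMap

theorem antisymmetrize_apply (f : MvPolynomial (Fin d) A) :
    antisymmetrize d A f = ∑ σ : Equiv.Perm (Fin d), (Equiv.Perm.sign σ : ℤ) • rename σ f := by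
  simp [antisymmetrize]

theorem antisymmetrize_factorialMonomial (b : ℕ → A) (k : Fin d → ℕ) :
    antisymmetrize d A (factorialMonomial b k) = alternant b k := by
  rw [antisymmetrize_apply, alternant, ← Matrix.det_transpose, Matrix.det_apply]
  refine Finset.sum_congr rfl fun σ _ => ?_
  simp [factorialMonomial, map_prod, Units.smul_def]

theorem antisymmetrize_mul {f : MvPolynomial (Fin d) A} (hf : f.IsSymmetric)
    (g : MvPolynomial (Fin d) A) :
    antisymmetrize d A (f * g) = f * antisymmetrize d A g := by
  simp only [antisymmetrize_apply, map_mul, hf _, Finset.mul_sum, mul_smul_comm]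

theorem X_mul_factorialMonomial (b : ℕ → A) (k : Fin d → ℕ) (i : Fin d) :
    X i * factorialMonomial b k = b (k i) • factorialMonomial b k +
      factorialMonomial b (Function.update k i (k i + 1)) := by
  have h : factorialMonomial b (Function.update k i (k i + 1)) =
      (X i - C (b (k i))) * factorialMonomial b k := by
    rw [factorialMonomial, factorialMonomial, ← Finset.mul_prod_erase _ _ (Finset.mem_univ i),
      ← Finset.mul_prod_erase Finset.univ
        (fun j => ∏ l ∈ Finset.range (k j), (X j - C (b l))) (Finset.mem_univ i),
      Function.update_self, Finset.prod_range_succ]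
    have : ∏ x ∈ Finset.univ.erase i,
        ∏ l ∈ Finset.range (Function.update k i (k i + 1) x), (X x - C (b l)) =
        ∏ x ∈ Finset.univ.erase i, ∏ l ∈ Finset.range (k x), (X x - C (b l)) :=
      Finset.prod_congr rfl fun x hx => by
        rw [Function.update_of_ne (Finset.ne_of_mem_erase hx)]
    rw [this]
    ring
  rw [h, smul_eq_C_mul]
  ring

/-- The span contains `1` and is stable under multiplication by each variable. -/
theorem span_factorialMonomial (b : ℕ → A) :
    Submodule.span A (Set.range (factorialMonomial b : (Fin d → ℕ) → _)) = ⊤ := by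
  rw [eq_top_iff]
  rintro f -
  induction f using MvPolynomial.induction_on with
  | C r =>
    have : (C r : MvPolynomial (Fin d) A) = r • factorialMonomial b 0 := by
      simp [factorialMonomial, smul_eq_C_mul]
    rw [this]
    exact Submodule.smul_mem _ _ (Submodule.subset_span ⟨0, rfl⟩)
  | add p q hp hq => exact add_mem hp hq
  | mul_X p i hp =>
    induction hp using Submodule.span_induction with
    | mem x hx =>
      obtain ⟨k, rfl⟩ := hx
      rw [mul_comm, X_mul_factorialMonomial]
      exact add_mem (Submodule.smul_mem _ _ (Submodule.subset_span ⟨_, rfl⟩))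
        (Submodule.subset_span ⟨_, rfl⟩)
    | zero => simp
    | add x y _ _ hx hy => rw [add_mul]; exact add_mem hx hy
    | smul r x _ hx => rw [smul_mul_assoc]; exact Submodule.smul_mem _ _ hx

/-- The product of a symmetric polynomial with the Vandermonde product, which is the alternant of
the empty partition, is the antisymmetrization of a combination of factorial monomials. -/
theorem mem_span_schur_of_isSymmetric [IsDomain A] (b : ℕ → A) {f : MvPolynomial (Fin d) A}
    (hf : f.IsSymmetric) : f ∈ Submodule.span A (Set.range (schur b : Part d → _)) := by
  have key (g : MvPolynomial (Fin d) A) :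
      ∃ z ∈ Submodule.span A (Set.range (schur b : Part d → _)),
        antisymmetrize d A g = vandermondeProd d A * z := by
    have hg : g ∈ Submodule.span A (Set.range (factorialMonomial b : (Fin d → ℕ) → _)) := by
      rw [span_factorialMonomial]
      trivial
    induction hg using Submodule.span_induction with
    | mem x hx =>
      obtain ⟨k, rfl⟩ := hx
      obtain ⟨z, hz, h⟩ := exists_alternant_eq b k
      exact ⟨z, Submodule.span_subset_span ℤ A _ hz, by rw [antisymmetrize_factorialMonomial, h]⟩
    | zero => exact ⟨0, zero_mem _, by simp⟩
    | add x y _ _ hx hy =>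
      obtain ⟨z, hz, h⟩ := hx
      obtain ⟨z', hz', h'⟩ := hy
      exact ⟨z + z', add_mem hz hz', by rw [map_add, h, h', mul_add]⟩
    | smul r x _ hx =>
      obtain ⟨z, hz, h⟩ := hx
      exact ⟨r • z, Submodule.smul_mem _ _ hz, by rw [map_smul, h, mul_smul_comm]⟩
  obtain ⟨z, hz, h⟩ := key (f * factorialMonomial b (idx (emptyPart d)))
  rw [antisymmetrize_mul hf, antisymmetrize_factorialMonomial, alternant_emptyPart, mul_comm] at h
  rwa [mul_left_cancel₀ vandermondeProd_ne_zero h]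

theorem rename_alternant (b : ℕ → A) (k : Fin d → ℕ) (σ : Equiv.Perm (Fin d)) :
    rename σ (alternant b k) = ((Equiv.Perm.sign σ : ℤ) : MvPolynomial (Fin d) A) *
      alternant b k := by
  rw [alternant, ← Matrix.det_permute', AlgHom.map_det]
  congr 1
  ext1 i j
  simp [map_prod]

/-- A quotient of two alternating polynomials is symmetric. -/
theorem isSymmetric_schur [IsDomain A] (b : ℕ → A) (lam : Part d) : (schur b lam).IsSymmetric := by
  intro σ
  have h := congrArg (rename σ) (vandermondeProd_mul_schur b lam)
  rw [map_mul, ← alternant_emptyPart b, rename_alternant, rename_alternant,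
    ← vandermondeProd_mul_schur b lam, alternant_emptyPart, mul_assoc] at h
  have hs : ((Equiv.Perm.sign σ : ℤ) : MvPolynomial (Fin d) A) ≠ 0 := by
    rcases Int.units_eq_one_or (Equiv.Perm.sign σ) with h | h <;> simp [h]
  exact mul_left_cancel₀ vandermondeProd_ne_zero (mul_left_cancel₀ hs h)

/-- A product of polynomials in the separate variables has as coefficients the products of their
coefficients. -/
theorem coeff_prod_aeval_X (p : Fin d → Polynomial A) (m : Fin d → ℕ) :
    coeff (Finsupp.equivFunOnFinite.symm m)
      (∏ i, Polynomial.aeval (X i : MvPolynomial (Fin d) A) (p i)) = ∏ i, (p i).coeff (m i) := by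
  have h (i : Fin d) : Polynomial.aeval (X i : MvPolynomial (Fin d) A) (p i) =
      ∑ n ∈ Finset.range ((p i).natDegree + 1),
        monomial (Finsupp.single i n) ((p i).coeff n) := by
    rw [Polynomial.aeval_eq_sum_range]
    simp [smul_eq_C_mul, monomial_eq]
  have hprod (n : Fin d → ℕ) (s : Finset (Fin d)) :
      ∏ i ∈ s, monomial (Finsupp.single i (n i)) ((p i).coeff (n i)) =
        monomial (∑ i ∈ s, Finsupp.single i (n i)) (∏ i ∈ s, (p i).coeff (n i)) := by
    induction s using Finset.cons_induction with
    | empty => simp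
    | cons i s hi ih => simp only [Finset.prod_cons, Finset.sum_cons, ih, monomial_mul]
  have hn (n : Fin d → ℕ) :
      ∑ i, Finsupp.single i (n i) = Finsupp.equivFunOnFinite.symm n := by
    ext i
    simp [Finsupp.single_apply]
  simp_rw [h, Finset.prod_univ_sum, hprod, hn, coeff_sum, coeff_monomial,
    EmbeddingLike.apply_eq_iff_eq]
  rw [Finset.sum_ite_eq']
  split_ifs with hm
  · rfl
  · simp only [Fintype.mem_piFinset, Finset.mem_range, not_forall, not_lt] at hm
    obtain ⟨i, hi⟩ := hm
    exact (Finset.prod_eq_zero (Finset.mem_univ i)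
      (Polynomial.coeff_eq_zero_of_natDegree_lt hi)).symm

theorem eq_one_of_comp_eq {k m : Fin d → ℕ} (hk : StrictAnti k) (hm : StrictAnti m)
    {σ : Equiv.Perm (Fin d)} (h : k ∘ σ = m) : σ = 1 := by
  have hσ : StrictMono σ := fun i j hij => by
    have := hm hij
    rw [← h] at this
    exact hk.lt_iff_gt.1 this
  ext1 i
  exact congrFun ((hσ.range_inj strictMono_id).1 (by simp)) i

/-- Among the partitions of size at most that of `lam`, only `lam` itself has an alternant that
involves the monomial with exponents `idx lam`. -/
theorem coeff_alternant [Nontrivial A] (b : ℕ → A) {lam mu : Part d}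
    (h : ∑ i, idx mu i ≤ ∑ i, idx lam i) :
    coeff (Finsupp.equivFunOnFinite.symm (idx lam)) (alternant b (idx mu)) =
      if mu = lam then 1 else 0 := by
  have hzero (σ : Equiv.Perm (Fin d)) (hne : idx mu ∘ σ ≠ idx lam) :
      ∏ i, (factorialPoly b (idx mu (σ i))).coeff (idx lam i) = 0 := by
    have hlt : ∃ i, idx mu (σ i) < idx lam i := by
      by_contra! hge
      refine hne (funext fun i => ?_)
      have hsum : ∑ i, idx lam i = ∑ i, idx mu (σ i) :=
        le_antisymm (Finset.sum_le_sum fun i _ => hge i) ((Equiv.sum_comp σ (idx mu)).trans_le h)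
      exact ((Finset.sum_eq_sum_iff_of_le fun i _ => hge i).1 hsum i (Finset.mem_univ i)).symm
    obtain ⟨i, hi⟩ := hlt
    refine Finset.prod_eq_zero (Finset.mem_univ i) (Polynomial.coeff_eq_zero_of_natDegree_lt ?_)
    rwa [natDegree_factorialPoly]
  have hexp : coeff (Finsupp.equivFunOnFinite.symm (idx lam)) (alternant b (idx mu)) =
      ∑ σ : Equiv.Perm (Fin d), Equiv.Perm.sign σ •
        ∏ i, (factorialPoly b (idx mu (σ i))).coeff (idx lam i) := by
    rw [alternant, Matrix.det_apply, coeff_sum]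
    refine Finset.sum_congr rfl fun σ _ => ?_
    rw [← coeff_prod_aeval_X fun i => factorialPoly b (idx mu (σ i))]
    simp only [Matrix.of_apply, aeval_factorialPoly, Units.smul_def, coeff_smul]
  rw [hexp]
  split_ifs with hml
  · subst hml
    rw [Finset.sum_eq_single 1]
    · have hc (i : Fin d) : (factorialPoly b (idx mu i)).coeff (idx mu i) = 1 := by
        have := factorialPoly_monic b (idx mu i)
        rwa [Polynomial.Monic, Polynomial.leadingCoeff, natDegree_factorialPoly] at this
      simp [hc]
    · intro σ _ hσ
      rw [hzero σ fun e => hσ (eq_one_of_comp_eq (idx_strictAnti mu) (idx_strictAnti mu) e),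
        smul_zero]
    · simp
  · refine Finset.sum_eq_zero fun σ _ => ?_
    rw [hzero σ, smul_zero]
    intro e
    have := eq_one_of_comp_eq (idx_strictAnti mu) (idx_strictAnti lam) e
    subst this
    exact hml (idx_injective e)

/-- In a linear relation, compare the coefficients of the monomial with exponents `idx lam` for a
largest `lam` that occurs. -/
theorem linearIndependent_schur [IsDomain A] (b : ℕ → A) :
    LinearIndependent A (schur b : Part d → _) := by
  rw [linearIndependent_iff]
  intro l hl
  by_contra hne
  obtain ⟨lam, hlam, hmax⟩ := Finset.exists_max_image l.support (fun mu => ∑ i, idx mu i)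
    (Finsupp.support_nonempty_iff.2 hne)
  have h := congrArg (fun f => coeff (Finsupp.equivFunOnFinite.symm (idx lam))
    (vandermondeProd d A * f)) hl
  simp only [Finsupp.linearCombination_apply, Finsupp.sum, Finset.mul_sum, mul_smul_comm,
    vandermondeProd_mul_schur, coeff_sum, coeff_smul, mul_zero, coeff_zero] at h
  rw [Finset.sum_congr rfl fun mu hmu => by rw [coeff_alternant b (hmax mu hmu)]] at h
  simp only [smul_eq_mul, mul_ite, mul_one, mul_zero, Finset.sum_ite_eq', if_pos hlam] at h
  exact Finsupp.mem_support_iff.1 hlam h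

end

/-! ### The shifted variables -/

theorem algebraMap_vSum_mul_xOverV (d : ℕ) :
    C (algebraMap (MvPolynomial (Fin d) ℤ) (Vloc d) (vSum d)) * xOverV d =
      ∑ i, (X i : VX d) := by
  rw [xOverV, ← mul_assoc, ← C_mul, IsLocalization.Away.mul_invSelf, C_1, one_mul]

theorem sum_shiftX (d : ℕ) : ∑ i : Fin d, shiftX i = 0 := by
  simp only [shiftX, Finset.sum_sub_distrib, ← Finset.sum_mul]
  rw [← map_sum, ← map_sum, sub_eq_zero, ← algebraMap_vSum_mul_xOverV]
  rfl

theorem permV_algebraMap {d : ℕ} (σ : Equiv.Perm (Fin d)) (p : MvPolynomial (Fin d) ℤ) :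
    permV σ (algebraMap _ _ p) = algebraMap _ (Vloc d) (rename σ p) :=
  IsLocalization.map_eq _ p

theorem permVX_X {d : ℕ} (σ : Equiv.Perm (Fin d)) (i : Fin d) :
    permVX σ (X i) = X (σ i) := by
  simp [permVX]

theorem permVX_C {d : ℕ} (σ : Equiv.Perm (Fin d)) (r : Vloc d) :
    permVX σ (C r) = C (permV σ r) := by
  simp [permVX]

theorem permV_invSelf {d : ℕ} (σ : Equiv.Perm (Fin d)) :
    permV σ (IsLocalization.Away.invSelf (vSum d)) = IsLocalization.Away.invSelf (vSum d) := by
  have h : algebraMap _ (Vloc d) (vSum d) * IsLocalization.Away.invSelf (vSum d) = 1 :=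
    IsLocalization.Away.mul_invSelf (vSum d)
  have h2 := congrArg (permV σ) h
  rw [map_mul, permV_algebraMap, rename_vSum, map_one] at h2
  exact (IsUnit.of_mul_eq_one _ h).mul_left_cancel (h2.trans h.symm)

theorem permVX_xOverV {d : ℕ} (σ : Equiv.Perm (Fin d)) : permVX σ (xOverV d) = xOverV d := by
  rw [xOverV, map_mul, permVX_C, permV_invSelf, map_sum]
  simp only [permVX_X]
  rw [Equiv.sum_comp σ fun i => (X i : VX d)]

theorem permVX_shiftX {d : ℕ} (σ : Equiv.Perm (Fin d)) (i : Fin d) :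
    permVX σ (shiftX i) = shiftX (σ i) := by
  simp only [shiftX, map_sub, map_mul, permVX_X, permVX_C, permV_algebraMap, permVX_xOverV,
    rename_X]

theorem aeval_shiftX_mem_invVX {d : ℕ} {f : MvPolynomial (Fin d) ℤ} (hf : f.IsSymmetric) :
    aeval shiftX f ∈ invVX d := by
  intro σ
  have h : (permVX σ).comp (aeval shiftX : MvPolynomial (Fin d) ℤ →ₐ[ℤ] VX d).toRingHom =
      ((aeval shiftX).comp (rename σ) : MvPolynomial (Fin d) ℤ →ₐ[ℤ] VX d).toRingHom :=
    MvPolynomial.ringHom_ext (by simp) fun i => by simp [permVX_shiftX]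
  refine (DFunLike.congr_fun h f).trans ?_
  simp only [AlgHom.toRingHom_eq_coe, RingHom.coe_coe, AlgHom.comp_apply, hf σ]

/-! ### Evaluation at the shifted variables -/

section

variable (d : ℕ) (R : Type) [CommRing R]

/-- The `R`-algebra homomorphism from `R[t][x_1, …, x_d]` that substitutes the shifted variables for
the `x_i` and `x / v` for `t`, where `x` and `v` are the sums of the `x`- and the `v`-variables. -/
def shiftEval : MvPolynomial (Fin d) (Polynomial R) →ₐ[R] R ⊗[ℤ] VX d :=
  aevalTower (Polynomial.aeval ((1 : R) ⊗ₜ[ℤ] xOverV d)) fun i => (1 : R) ⊗ₜ[ℤ] shiftX i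

theorem shiftEval_X (i : Fin d) : shiftEval d R (X i) = (1 : R) ⊗ₜ[ℤ] shiftX i :=
  aevalTower_X _ _ _

theorem shiftEval_C (p : Polynomial R) :
    shiftEval d R (C p) = Polynomial.aeval ((1 : R) ⊗ₜ[ℤ] xOverV d) p :=
  aevalTower_C _ _ _

theorem smul_eq_algebraMap_mul {d : ℕ} {R : Type} [CommRing R] (r : R) (f : R ⊗[ℤ] VX d) :
    r • f = algebraMap R (R ⊗[ℤ] VX d) r * f :=
  Algebra.smul_def r f

theorem shiftEval_sum_X : shiftEval d R (∑ i, X i) = 0 := by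
  simp only [map_sum, shiftEval_X]
  rw [← TensorProduct.tmul_sum, sum_shiftX, TensorProduct.tmul_zero]

/-- The specialisation `v_{i₀} = 1`, `v_i = 0` for `i ≠ i₀`. -/
def evalV {d : ℕ} (i₀ : Fin d) : Vloc d →+* ℤ :=
  IsLocalization.Away.lift (vSum d) (g := eval (Pi.single i₀ 1)) (by simp [vSum])

/-- The homomorphism `R ⊗ ℤ[v]_loc[x] → R[t][x]` that specialises `v` by `evalV` and adds `t` to
`x_{i₀}`. -/
def unshift {d : ℕ} (i₀ : Fin d) :
    R ⊗[ℤ] VX d →ₐ[R] MvPolynomial (Fin d) (Polynomial R) :=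
  Algebra.TensorProduct.lift (Algebra.ofId R _)
    (eval₂Hom ((Int.castRingHom _).comp (evalV i₀))
      fun i => X i + if i = i₀ then C Polynomial.X else 0).toIntAlgHom
    fun _ _ => Commute.all _ _

theorem evalV_algebraMap {d : ℕ} (i₀ : Fin d) (p : MvPolynomial (Fin d) ℤ) :
    evalV i₀ (algebraMap _ _ p) = eval (Pi.single i₀ 1) p :=
  IsLocalization.Away.lift_eq _ _ _

theorem evalV_invSelf {d : ℕ} (i₀ : Fin d) :
    evalV i₀ (IsLocalization.Away.invSelf (vSum d)) = 1 := by
  have h := congrArg (evalV i₀)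
    (IsLocalization.Away.mul_invSelf (S := Vloc d) (vSum d))
  rw [map_mul, evalV_algebraMap, map_one] at h
  simpa [vSum] using h

variable {d}

theorem unshift_one_tmul (i₀ : Fin d) (f : VX d) :
    unshift R i₀ (1 ⊗ₜ f) = eval₂Hom ((Int.castRingHom _).comp (evalV i₀))
      (fun i => X i + if i = i₀ then C Polynomial.X else 0) f :=
  (Algebra.TensorProduct.lift_tmul _ _ _ _ _).trans (by rw [map_one, one_mul]; rfl)

/-- As `v_1 + ⋯ + v_d` specialises to `1`, so `x / v` becomes the sum of the substituted `x_i`. -/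
theorem unshift_xOverV (i₀ : Fin d) :
    unshift R i₀ (1 ⊗ₜ xOverV d) = C Polynomial.X + ∑ i, X i := by
  rw [unshift_one_tmul]
  simp [xOverV, evalV_invSelf, Finset.sum_add_distrib, add_comm]

theorem unshift_shiftX (i₀ i : Fin d) :
    unshift R i₀ (1 ⊗ₜ shiftX i) = X i - if i = i₀ then ∑ j, X j else 0 := by
  have h := unshift_xOverV R i₀
  rw [unshift_one_tmul] at h ⊢
  rw [shiftX, map_sub, map_mul, h]
  by_cases hi : i = i₀
  · subst hi
    simp [evalV_algebraMap]
    ring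
  · simp [evalV_algebraMap, hi]

/-- The kernel of `shiftEval` is generated by `x_1 + ⋯ + x_d`: modulo that element, `unshift` is a
left inverse of `shiftEval`. -/
theorem sum_X_dvd_of_shiftEval_eq_zero (i₀ : Fin d)
    {f : MvPolynomial (Fin d) (Polynomial R)} (hf : shiftEval d R f = 0) : ∑ i, X i ∣ f := by
  let I : Ideal (MvPolynomial (Fin d) (Polynomial R)) := Ideal.span {∑ i, X i}
  have hI : Ideal.Quotient.mk I (∑ i, X i) = 0 :=
    Ideal.Quotient.eq_zero_iff_mem.2 (Ideal.mem_span_singleton_self _)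
  have h : ((Ideal.Quotient.mk I).comp (unshift R i₀).toRingHom).comp (shiftEval d R).toRingHom =
      Ideal.Quotient.mk I := by
    refine MvPolynomial.ringHom_ext' (Polynomial.ringHom_ext' ?_ ?_) fun i => ?_
    · ext r
      simp only [RingHom.comp_apply, AlgHom.toRingHom_eq_coe, RingHom.coe_coe, shiftEval_C,
        Polynomial.aeval_C, AlgHom.commutes]
      rfl
    · simp only [RingHom.comp_apply, AlgHom.toRingHom_eq_coe, RingHom.coe_coe, shiftEval_C,
        Polynomial.aeval_X, unshift_xOverV, map_add, hI, add_zero]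
    · simp only [RingHom.comp_apply, AlgHom.toRingHom_eq_coe, RingHom.coe_coe, shiftEval_X,
        unshift_shiftX, map_sub]
      split_ifs <;> simp [hI]
  have h1 := DFunLike.congr_fun h f
  rw [RingHom.comp_apply] at h1
  rw [← Ideal.mem_span_singleton, ← Ideal.Quotient.eq_zero_iff_mem, ← h1]
  simp [hf]

/-- The image of the symmetric polynomials under `shiftEval`. -/
def shiftedAlgebra (d : ℕ) (R : Type) [CommRing R] : Subalgebra R (R ⊗[ℤ] VX d) :=
  ((symmetricSubalgebra (Fin d) (Polynomial R)).restrictScalars R).map (shiftEval d R)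

theorem shiftEval_mem_shiftedAlgebra {f : MvPolynomial (Fin d) (Polynomial R)}
    (hf : f.IsSymmetric) : shiftEval d R f ∈ shiftedAlgebra d R :=
  ⟨f, hf, rfl⟩

theorem tmul_mem_invariants {f : VX d} (hf : f ∈ invVX d) :
    (1 : R) ⊗ₜ[ℤ] f ∈ invariants d R :=
  ⟨1 ⊗ₜ ⟨f, hf⟩, by simp [invIncl]⟩

/-- By the fundamental theorem on symmetric polynomials, it is enough to look at the images of `t`
and of the elementary symmetric polynomials. -/
theorem shiftedAlgebra_le_invariants : shiftedAlgebra d R ≤ invariants d R := by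
  rintro _ ⟨f, hf, rfl⟩
  obtain ⟨p, hp⟩ := esymmAlgHom_surjective (σ := Fin d) (n := d) (Polynomial R) (by simp) ⟨f, hf⟩
  obtain rfl : ((esymmAlgHom (Fin d) (Polynomial R) d p : symmetricSubalgebra _ _) :
      MvPolynomial (Fin d) (Polynomial R)) = f := congrArg Subtype.val hp
  clear hp hf
  change shiftEval d R _ ∈ _
  induction p using MvPolynomial.induction_on with
  | C r =>
    have : ((esymmAlgHom (Fin d) (Polynomial R) d (C r) : symmetricSubalgebra _ _) :
        MvPolynomial (Fin d) (Polynomial R)) = C r := by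
      rw [← algebraMap_eq, AlgHom.commutes]
      rfl
    rw [this, shiftEval_C]
    refine Algebra.adjoin_le ?_ (Polynomial.aeval_mem_adjoin_singleton R _)
    rw [Set.singleton_subset_iff]
    exact tmul_mem_invariants R permVX_xOverV
  | add p q hp hq =>
    rw [map_add, Subalgebra.coe_add, map_add]
    exact add_mem hp hq
  | mul_X p i hp =>
    rw [map_mul, Subalgebra.coe_mul, map_mul]
    refine mul_mem hp ?_
    have h1 : shiftEval d R (esymm (Fin d) (Polynomial R) (i + 1)) =
        1 ⊗ₜ aeval shiftX (esymm (Fin d) ℤ (i + 1)) := by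
      have hc : (((shiftEval d R).restrictScalars ℤ).comp
          (aeval (R := ℤ) X) : MvPolynomial (Fin d) ℤ →ₐ[ℤ] R ⊗[ℤ] VX d) =
          Algebra.TensorProduct.includeRight.comp (aeval shiftX) :=
        algHom_ext fun i => by simp [shiftEval_X]
      have h2 := DFunLike.congr_fun hc (esymm (Fin d) ℤ (i + 1))
      have h4 (S : Type) [CommRing S] : aeval (R := ℤ) (X : Fin d → MvPolynomial (Fin d) S)
          (esymm (Fin d) ℤ (i + 1)) = esymm (Fin d) S (i + 1) := by
        simp [esymm, map_sum, map_prod]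
      rw [← h4]
      exact h2
    have h3 : ((esymmAlgHom (Fin d) (Polynomial R) d (X i) : symmetricSubalgebra _ _) :
        MvPolynomial (Fin d) (Polynomial R)) = esymm (Fin d) (Polynomial R) (i + 1) := by
      simp [esymmAlgHom_apply]
    rw [h3, h1]
    exact tmul_mem_invariants R (aeval_shiftX_mem_invVX (esymm_isSymmetric _ _ _))

end

/-! ### The span of the shifted Schur functions -/

section

variable {d : ℕ} {R : Type} [CommRing R] (w a : ℕ → R)

/-- The parameter `a_l - w_l t`. -/
def shiftParam (l : ℕ) : Polynomial R := Polynomial.C (a l) - Polynomial.C (w l) * Polynomial.X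

theorem shiftEval_schur (lam : Part d) :
    shiftEval d R (schur (shiftParam w a) lam) = shiftedSchur w a lam := by
  have h : ((shiftEval d R).restrictScalars ℤ).comp
      (aeval (R := ℤ) (Sum.elim X fun l => C (shiftParam w a l))) =
      aeval (R := ℤ) (Sum.elim (fun i : Fin d => (1 : R) ⊗ₜ[ℤ] shiftX i) (shiftA d w a)) := by
    refine algHom_ext fun i => ?_
    rcases i with i | l
    · simp [shiftEval_X]
    · simp [shiftEval_C, shiftParam, shiftA, Algebra.TensorProduct.algebraMap_apply]
  exact DFunLike.congr_fun h (factorialSchur lam)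

variable [IsDomain R]

/-- As the shifted variables sum to zero, the Pieri rule expresses the product of `x / v` and
`s_lam` through Schur functions, up to division by `w_lam`. -/
theorem mul_mem_span_shiftedSchur (hw : ∀ lam : Part d, IsUnit (∑ i, w (idx lam i)))
    {f : R ⊗[ℤ] VX d} (hf : f ∈ Submodule.span R (Set.range (shiftedSchur w a : Part d → _))) :
    (1 : R) ⊗ₜ[ℤ] xOverV d * f ∈ Submodule.span R (Set.range (shiftedSchur w a : Part d → _)) := by
  induction hf using Submodule.span_induction with
  | mem x hx =>
    obtain ⟨lam, rfl⟩ := hx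
    obtain ⟨z, hz, h⟩ := exists_sum_X_mul_schur (shiftParam w a) lam
    have hz' : shiftEval d R z ∈
        Submodule.span R (Set.range (shiftedSchur w a : Part d → _)) := by
      refine Submodule.span_subset_span ℤ R _ ?_
      have := Submodule.mem_map_of_mem (f := ((shiftEval d R).restrictScalars ℤ).toLinearMap) hz
      rw [Submodule.map_span, ← Set.range_comp] at this
      rw [← funext (shiftEval_schur w a)]
      exact this
    have h1 := congrArg (shiftEval d R) h
    rw [map_mul, shiftEval_sum_X, zero_mul, map_add, map_mul, shiftEval_schur, shiftEval_C] at h1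
    -- `h1` now reads `0 = (a_lam - w_lam (x / v)) s_lam + z` at the shifted variables
    have h2 : Polynomial.aeval ((1 : R) ⊗ₜ[ℤ] xOverV d) (∑ i, shiftParam w a (idx lam i)) =
        algebraMap R _ (∑ i, a (idx lam i)) -
          algebraMap R _ (∑ i, w (idx lam i)) * (1 : R) ⊗ₜ[ℤ] xOverV d := by
      simp [shiftParam, Finset.sum_sub_distrib, Finset.sum_mul]
    rw [h2] at h1
    rw [← Submodule.smul_mem_iff_of_isUnit _ (hw lam)]
    have h3 : (∑ i, w (idx lam i)) • ((1 : R) ⊗ₜ[ℤ] xOverV d * shiftedSchur w a lam) =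
        (∑ i, a (idx lam i)) • shiftedSchur w a lam + shiftEval d R z := by
      rw [smul_eq_algebraMap_mul, smul_eq_algebraMap_mul]
      linear_combination h1
    rw [h3]
    exact add_mem (Submodule.smul_mem _ _ (Submodule.subset_span ⟨lam, rfl⟩)) hz'
  | zero => simp
  | add x y _ _ hx hy => rw [mul_add]; exact add_mem hx hy
  | smul r x _ hx => rw [mul_smul_comm]; exact Submodule.smul_mem _ _ hx

theorem aeval_mul_mem_span_shiftedSchur (hw : ∀ lam : Part d, IsUnit (∑ i, w (idx lam i)))
    (p : Polynomial R) {f : R ⊗[ℤ] VX d}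
    (hf : f ∈ Submodule.span R (Set.range (shiftedSchur w a : Part d → _))) :
    Polynomial.aeval ((1 : R) ⊗ₜ[ℤ] xOverV d) p * f ∈
      Submodule.span R (Set.range (shiftedSchur w a : Part d → _)) := by
  induction p using Polynomial.induction_on' with
  | add p q hp hq => rw [map_add, add_mul]; exact add_mem hp hq
  | monomial n r =>
    rw [Polynomial.aeval_monomial, mul_assoc, ← Algebra.smul_def]
    refine Submodule.smul_mem _ _ ?_
    induction n with
    | zero => simpa using hf
    | succ n ih =>
      rw [pow_succ', mul_assoc]
      exact mul_mem_span_shiftedSchur w a hw ih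

theorem toSubmodule_shiftedAlgebra (hw : ∀ lam : Part d, IsUnit (∑ i, w (idx lam i))) :
    Subalgebra.toSubmodule (shiftedAlgebra d R) =
      Submodule.span R (Set.range (shiftedSchur w a : Part d → _)) := by
  apply le_antisymm
  · rintro _ ⟨f, hf, rfl⟩
    have h := mem_span_schur_of_isSymmetric (shiftParam w a) hf
    clear hf
    change shiftEval d R f ∈ _
    induction h using Submodule.span_induction with
    | mem x hx =>
      obtain ⟨lam, rfl⟩ := hx
      rw [shiftEval_schur]
      exact Submodule.subset_span ⟨lam, rfl⟩
    | zero => rw [map_zero]; exact zero_mem _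
    | add x y _ _ hx hy => rw [map_add]; exact add_mem hx hy
    | smul r x _ hx =>
      rw [smul_eq_C_mul, map_mul, shiftEval_C]
      exact aeval_mul_mem_span_shiftedSchur w a hw r hx
  · rw [Submodule.span_le]
    rintro _ ⟨lam, rfl⟩
    rw [← shiftEval_schur]
    exact shiftEval_mem_shiftedAlgebra R (isSymmetric_schur _ lam)

theorem sum_X_ne_zero (i₀ : Fin d) :
    (∑ i, X i : MvPolynomial (Fin d) (Polynomial R)) ≠ 0 := by
  intro h
  have := congrArg (eval (Pi.single i₀ 1)) h
  simp at this

/-- A linear relation gives a combination of the `s_lam` with coefficients free of `t` that is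
divisible by `x_1 + ⋯ + x_d`. By the Pieri rule, multiplication by `x_1 + ⋯ + x_d` raises the
degree in `t` of the coefficients, because each `w_lam` is a unit. -/
theorem linearIndependent_shiftedSchur (i₀ : Fin d)
    (hw : ∀ lam : Part d, IsUnit (∑ i, w (idx lam i))) :
    LinearIndependent R (shiftedSchur w a : Part d → _) := by
  set s := schur (d := d) (shiftParam w a) with hs
  have hli : LinearIndependent (Polynomial R) s := linearIndependent_schur _
  rw [linearIndependent_iff]
  intro c hc
  set c' : Part d →₀ Polynomial R := c.mapRange Polynomial.C (map_zero _) with hc'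
  have h0 : shiftEval d R (Finsupp.linearCombination (Polynomial R) s c') = 0 := by
    rw [← hc, Finsupp.linearCombination_apply, Finsupp.linearCombination_apply,
      Finsupp.sum_mapRange_index (by simp), Finsupp.sum, Finsupp.sum, map_sum]
    refine Finset.sum_congr rfl fun lam _ => ?_
    rw [smul_eq_C_mul, map_mul, shiftEval_C, Polynomial.aeval_C, hs, shiftEval_schur,
      smul_eq_algebraMap_mul]
  obtain ⟨g, hg⟩ := sum_X_dvd_of_shiftEval_eq_zero R i₀ h0
  have hgsym : g.IsSymmetric := by
    intro σ
    have hsym : (Finsupp.linearCombination (Polynomial R) s c').IsSymmetric := by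
      rw [← mem_symmetricSubalgebra, Finsupp.linearCombination_apply, Finsupp.sum]
      exact Subalgebra.sum_mem _ fun lam _ =>
        Subalgebra.smul_mem _ ((mem_symmetricSubalgebra _).2 (isSymmetric_schur _ lam)) _
    have h1 := hsym σ
    rw [hg, map_mul, map_sum] at h1
    simp only [rename_X] at h1
    rw [Equiv.sum_comp σ fun i => (X i : MvPolynomial (Fin d) (Polynomial R))] at h1
    exact mul_left_cancel₀ (sum_X_ne_zero i₀) h1
  obtain ⟨f, hf⟩ := (Finsupp.mem_span_range_iff_exists_finsupp).1
    (mem_span_schur_of_isSymmetric (shiftParam w a) hgsym)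
  choose z hz hpieri using exists_sum_X_mul_schur (d := d) (shiftParam w a)
  choose n hn using fun lam => (Finsupp.mem_span_range_iff_exists_finsupp).1 (hz lam)
  -- the coefficients of the product of `x_1 + ⋯ + x_d` and `s_lam`
  let p (lam : Part d) : Part d →₀ Polynomial R :=
    Finsupp.single lam (∑ i, shiftParam w a (idx lam i)) +
      (n lam).mapRange (Int.cast : ℤ → Polynomial R) Int.cast_zero
  have hp (lam : Part d) :
      Finsupp.linearCombination (Polynomial R) s (p lam) = (∑ i, X i) * s lam := by
    rw [map_add, Finsupp.linearCombination_single, hs, hpieri, smul_eq_C_mul, ← hn lam,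
      Finsupp.linearCombination_apply, Finsupp.sum_mapRange_index (by simp)]
    simp only [Int.cast_smul_eq_zsmul]
  have hcf : c' = Finsupp.linearCombination (Polynomial R) p f := by
    apply hli
    rw [hg, ← hf, Finsupp.linearCombination_apply _ f, Finsupp.sum, Finsupp.sum, map_sum,
      Finset.mul_sum]
    refine Finset.sum_congr rfl fun lam _ => ?_
    rw [map_smul, hp, mul_smul_comm]
  have hdeg (mu lam : Part d) : (p mu lam).natDegree ≤ 1 := by
    have h1 (l : ℕ) : (shiftParam w a l).natDegree ≤ 1 := by
      unfold shiftParam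
      compute_degree
    rw [Finsupp.add_apply, Finsupp.mapRange_apply]
    refine (Polynomial.natDegree_add_le _ _).trans (max_le ?_ (by simp))
    rw [Finsupp.single_apply]
    split_ifs
    · exact Polynomial.natDegree_sum_le_of_forall_le _ _ fun i _ => h1 _
    · simp
  have hcoeff (mu lam : Part d) :
      (p mu lam).coeff 1 = if mu = lam then -∑ i, w (idx lam i) else 0 := by
    have h1 (k : ℤ) : (k : Polynomial R).coeff 1 = 0 := by
      rw [← map_intCast (Polynomial.C : R →+* Polynomial R), Polynomial.coeff_C_succ]
    rw [Finsupp.add_apply, Finsupp.mapRange_apply, Polynomial.coeff_add, h1, Finsupp.single_apply]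
    split_ifs with h
    · subst h
      simp [shiftParam, Polynomial.coeff_C]
    · simp
  have hf0 : f = 0 := by
    by_contra hne
    obtain ⟨lam, hlam, hmax⟩ := Finset.exists_max_image f.support (fun mu => (f mu).natDegree)
      (Finsupp.support_nonempty_iff.2 hne)
    -- compare the coefficients of `t ^ (D + 1)`, where `D` is the largest degree among the `f mu`
    have h1 := congrArg (fun q => Polynomial.coeff (q lam) ((f lam).natDegree + 1)) hcf
    simp only [hc', Finsupp.mapRange_apply, Polynomial.coeff_C_succ,
      Finsupp.linearCombination_apply, Finsupp.sum, Finsupp.finsetSum_apply, Finsupp.smul_apply,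
      smul_eq_mul, Polynomial.finsetSum_coeff] at h1
    rw [Finset.sum_congr rfl fun mu hmu => by
      rw [Polynomial.coeff_mul_add_eq_of_natDegree_le (hmax mu hmu) (hdeg mu lam), hcoeff]] at h1
    simp only [mul_ite, mul_zero, Finset.sum_ite_eq', if_pos hlam] at h1
    rw [eq_comm, mul_neg, neg_eq_zero, (hw lam).mul_left_eq_zero] at h1
    exact Finsupp.mem_support_iff.1 hlam (Polynomial.leadingCoeff_eq_zero.1 h1)
  ext lam
  have h2 := DFunLike.congr_fun hcf lam
  rw [hf0, map_zero, hc', Finsupp.mapRange_apply] at h2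
  simpa using h2

/-- The common form of both parts: the coefficient ring is a domain in which every `w_lam` is a unit,
and the parameters `a` are arbitrary elements of it. -/
theorem exists_subalgebra_basis (i₀ : Fin d)
    (hw : ∀ lam : Part d, IsUnit (∑ i, w (idx lam i))) :
    ∃ H : Subalgebra R (R ⊗[ℤ] VX d),
      Subalgebra.toSubmodule H = Submodule.span R (Set.range (shiftedSchur w a : Part d → _)) ∧
      H ≤ invariants d R ∧
      ∃ b : Module.Basis (Part d) R H,
        ∀ lam : Part d, (b lam : R ⊗[ℤ] VX d) = shiftedSchur w a lam := by
  have h := toSubmodule_shiftedAlgebra (d := d) w a hw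
  refine ⟨shiftedAlgebra d R, h, shiftedAlgebra_le_invariants R,
    ((Module.Basis.span (linearIndependent_shiftedSchur w a i₀ hw)).map
      (LinearEquiv.ofEq _ _ h.symm)).map (Subalgebra.toSubmoduleEquiv _), fun lam => ?_⟩
  rw [Module.Basis.map_apply, Module.Basis.map_apply]
  exact congrArg Subtype.val
    (Module.Basis.span_apply (linearIndependent_shiftedSchur w a i₀ hw) lam)

end

/-! ### The coefficient rings -/

theorem isUnit_sum_varW {d : ℕ} (lam : Part d) : IsUnit (∑ i, varW d (idx lam i)) := by
  have h := IsLocalization.map_units (Wloc d)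
    (⟨wSum lam, Submonoid.subset_closure ⟨lam, rfl⟩⟩ : wSubmonoid d)
  simpa [wSum, varW] using h

theorem isDomain_Wloc {d : ℕ} (i₀ : Fin d) : IsDomain (Wloc d) := by
  refine IsLocalization.isDomain_of_le_nonZeroDivisors (M := wSubmonoid d) (Wloc d) ?_
  rw [wSubmonoid, Submonoid.closure_le]
  rintro _ ⟨lam, rfl⟩
  refine mem_nonZeroDivisors_of_ne_zero fun h => ?_
  have h1 := congrArg (eval fun _ => 1) h
  have : d ≠ 0 := (Fin.pos i₀).ne'
  simp [wSum, this] at h1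

end WeightedSchur

end

theorem theoremA (d : ℕ) (hd : 0 < d) :
    (∃ H : Subalgebra (WeightedSchur.WlocA d)
          (TensorProduct ℤ (WeightedSchur.WlocA d) (WeightedSchur.VX d)),
        Subalgebra.toSubmodule H = WeightedSchur.factorialSpan d ∧
        H ≤ WeightedSchur.invariants d (WeightedSchur.WlocA d) ∧
        ∃ b : Module.Basis (WeightedSchur.Part d) (WeightedSchur.WlocA d) H,
          ∀ lam : WeightedSchur.Part d,
            (b lam : TensorProduct ℤ (WeightedSchur.WlocA d) (WeightedSchur.VX d)) =
              WeightedSchur.weightedFactorialSchur lam) ∧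
    (∃ H : Subalgebra (WeightedSchur.Wloc d)
          (TensorProduct ℤ (WeightedSchur.Wloc d) (WeightedSchur.VX d)),
        Subalgebra.toSubmodule H = WeightedSchur.schurSpan d ∧
        H ≤ WeightedSchur.invariants d (WeightedSchur.Wloc d) ∧
        ∃ b : Module.Basis (WeightedSchur.Part d) (WeightedSchur.Wloc d) H,
          ∀ lam : WeightedSchur.Part d,
            (b lam : TensorProduct ℤ (WeightedSchur.Wloc d) (WeightedSchur.VX d)) =
              WeightedSchur.weightedSchur lam) := by
  have := WeightedSchur.isDomain_Wloc (⟨0, hd⟩ : Fin d)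
  refine ⟨WeightedSchur.exists_subalgebra_basis _ _ ⟨0, hd⟩ fun lam => ?_,
    WeightedSchur.exists_subalgebra_basis _ _ ⟨0, hd⟩ WeightedSchur.isUnit_sum_varW⟩
  rw [← map_sum]
  exact (WeightedSchur.isUnit_sum_varW lam).map MvPolynomial.C
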